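/- A \emph{tall tile} is a closed, simply connected (simple) polygon in $\mathbb R^2$ with all sides parallel to the axes and of height $1$ (side lengths may be irrational). For a finite set $T$ of tall tiles and a region $\Gamma$, a \emph{tiling} of $\Gamma$ with $T$ is a collection of translates of tiles in $T$ which do not overlap except along their boundaries and whose union is $\Gamma$. For $a>0$ let $R_a$ be the rectangle of height $1$ and length $a$, and let $R_0$ be the empty region, which has exactly one (empty) tiling. A function $f:\mathbb N\to\mathbb N$, where $\mathbb N=\{0,1,2,\dots\}$, is a \emph{tile counting function} if there are a finite set $T$ of tall tiles and a real number $\delta\ge 0$ such that, for every $n\in\mathbb N$, $f(n)$ is the number of tilings of $R_{n+\delta}$ with $T$. Let $C_n=\frac1{n+1}\binom{2n}{n}$ be the Catalan numbers. For every $\varepsilon>0$ there exist a tile counting function $f$ and a real number $A\in(1-\varepsilon,1+\varepsilon)$ such that $f(n)\sim A\,C_n$, that is, $\dfrac{f(n)}{A\,C_n}\to 1$ as $n\to\infty$. -/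

import Mathlib

open Filter Topology

namespace IrrationalTilings

/-- A (closed, simple) axis-parallel polygon in the plane: a finite union of nondegenerate closed
axis-parallel boxes which is simply connected and whose interior is connected. The last condition
excludes figures pinched at a point, such as two squares that share only a corner. -/
def IsAxisPolygon (τ : Set (ℝ × ℝ)) : Prop :=
  (∃ B : Set (Set (ℝ × ℝ)), B.Finite ∧
    (∀ R ∈ B, ∃ a b c d : ℝ, a < b ∧ c < d ∧ R = Set.Icc a b ×ˢ Set.Icc c d) ∧
    τ = ⋃₀ B) ∧
  IsSimplyConnected τ ∧
  IsConnected (interior τ)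

/-- A tall tile: an axis-parallel polygon of height `1`. -/
def IsTallTile (τ : Set (ℝ × ℝ)) : Prop :=
  IsAxisPolygon τ ∧ ∃ b : ℝ, Prod.snd '' τ = Set.Icc b (b + 1)

/-- `P` is a tiling of the region `Γ` with the set of tiles `T`: a finite collection of translates
of tiles from `T`, no two of which overlap (they may share boundary points), with union `Γ`. -/
def IsTiling (T : Set (Set (ℝ × ℝ))) (Γ : Set (ℝ × ℝ)) (P : Set (Set (ℝ × ℝ))) : Prop :=
  P.Finite ∧
  (∀ σ ∈ P, ∃ τ ∈ T, ∃ v : ℝ × ℝ, σ = (fun p => v + p) '' τ) ∧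
  (∀ σ ∈ P, ∀ σ' ∈ P, σ ≠ σ' → Disjoint (interior σ) (interior σ')) ∧
  ⋃₀ P = Γ

/-- The rectangle of height `1` and length `a`. For `a = 0` this is the empty region (not a
segment), which has exactly one tiling, the empty one. -/
def strip (a : ℝ) : Set (ℝ × ℝ) :=
  {p | 0 < a ∧ p.1 ∈ Set.Icc 0 a ∧ p.2 ∈ Set.Icc 0 1}

/-- `f` is a tile counting function: for some finite set `T` of tall tiles and some `ε ≥ 0`,
`f n` is the number of tilings with `T` of the rectangle of height `1` and length `n + ε`.
(`Set.encard` takes the value `⊤` on infinite sets, so the number of tilings is finite here.) -/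
def IsTileCountingFunction (f : ℕ → ℕ) : Prop :=
  ∃ (T : Set (Set (ℝ × ℝ))) (ε : ℝ), T.Finite ∧ (∀ τ ∈ T, IsTallTile τ) ∧ 0 ≤ ε ∧
    ∀ n : ℕ, Set.encard {P | IsTiling T (strip (n + ε)) P} = f n

/-- `f ∼ g`: the ratio `f n / g n` tends to `1` as `n → ∞`. -/
def AsymptoticTo (f g : ℕ → ℝ) : Prop :=
  Tendsto (fun n => f n / g n) atTop (𝓝 1)

end IrrationalTilings

namespace IrrationalTilings

/-! Rectangular tiles of height 1 suffice: a tiling of a strip is then a word whose letter lengths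
add up to the length of the strip (`encard_tilings_eq`). Fix a transcendental t in (0, 1) and take δ
= t ^ 6. The basic lengths are t, …, t ^ 5 and a sixth one making the combination with weights 2, 2,
1, 1, 1, 1 equal to 10. A marked letter of class j < 10 and index i < M * 4 ^ j has length t ^ 6 + j
+ 10 q + i (t - t ^ 2). For n = 10 (k + q) + j, comparing coefficients of powers of t forces one
marked letter, of class j, and basic letters occurring 2k - i, 2k + i, k, k, k, k times
(`sum_mul_letterLength_eq_iff`). For each fixed i these words number about 2 π^(-5/2) 4^(10k)
k^(-3/2) (`tendsto_wordCount`): the base is 8^8 / (2^2 · 2^2) = 4^10, the six basic letters give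
k^(-5/2), and the position of the marked letter gives back a factor 8k + 1. This is the Catalan
exponent. The M * 4 ^ j indices supply the missing 4 ^ j, so the ratio to C_n tends to M c / 4 ^ (10
q) with c = 20 √10 / π ^ 2, and suitable M and q bring this close to 1. -/

/-! ### Tilings by rectangles of height 1 as words -/

/-- The rectangle of height `1` and length `a` whose lower left corner is `(x, 0)`. -/
def rect (x a : ℝ) : Set (ℝ × ℝ) := Set.Icc x (x + a) ×ˢ Set.Icc 0 1

/-- The strip of length `a` which starts at abscissa `x`; it is empty for `a = 0`. -/
def stripFrom (x a : ℝ) : Set (ℝ × ℝ) :=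
  {p | 0 < a ∧ p.1 ∈ Set.Icc x (x + a) ∧ p.2 ∈ Set.Icc 0 1}

/-- The rectangles of lengths `len j`, for `j` in the word `l`, placed one after the other,
starting at abscissa `x`. -/
def wordTiling {J : Type*} (len : J → ℝ) : ℝ → List J → Set (Set (ℝ × ℝ))
  | _, [] => ∅
  | x, j :: l => insert (rect x (len j)) (wordTiling len (x + len j) l)

theorem strip_eq_stripFrom (a : ℝ) : strip a = stripFrom 0 a := by
  simp [strip, stripFrom]

theorem stripFrom_of_pos (x : ℝ) {a : ℝ} (ha : 0 < a) : stripFrom x a = rect x a := by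
  ext p
  simp only [stripFrom, rect, Set.mem_ofPred_eq, Set.mem_prod, ha, true_and]

theorem stripFrom_zero (x : ℝ) : stripFrom x 0 = ∅ := by
  simp [stripFrom]

theorem interior_rect (x a : ℝ) :
    interior (rect x a) = Set.Ioo x (x + a) ×ˢ Set.Ioo 0 1 := by
  rw [rect, interior_prod_eq, interior_Icc, interior_Icc]

theorem translate_rect (v : ℝ × ℝ) (a : ℝ) :
    (fun p => v + p) '' rect 0 a = Set.Icc v.1 (v.1 + a) ×ˢ Set.Icc v.2 (v.2 + 1) := by
  ext p
  simp only [rect, Set.mem_image, Set.mem_prod, Set.mem_Icc]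
  constructor
  · rintro ⟨q, ⟨⟨h1, h2⟩, h3, h4⟩, rfl⟩
    simp only [Prod.fst_add, Prod.snd_add]
    refine ⟨⟨?_, ?_⟩, ?_, ?_⟩ <;> linarith
  · rintro ⟨⟨h1, h2⟩, h3, h4⟩
    refine ⟨p - v, ?_, by abel⟩
    simp only [Prod.fst_sub, Prod.snd_sub]
    refine ⟨⟨?_, ?_⟩, ?_, ?_⟩ <;> linarith

theorem isTallTile_rect {a : ℝ} (ha : 0 < a) : IsTallTile (rect 0 a) := by
  have hconv : Convex ℝ (rect 0 a) := (convex_Icc _ _).prod (convex_Icc _ _)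
  have hne : (rect 0 a).Nonempty := ⟨(0, 0), by simp [rect, ha.le]⟩
  refine ⟨⟨⟨{rect 0 a}, Set.finite_singleton _, ?_, by simp⟩, ?_, ?_⟩, 0, ?_⟩
  · rintro R rfl
    exact ⟨0, 0 + a, 0, 1, by linarith, one_pos, rfl⟩
  · have := hconv.contractibleSpace hne
    exact (inferInstance : SimplyConnectedSpace (rect 0 a))
  · refine ⟨?_, hconv.interior.isPreconnected⟩
    rw [interior_rect]
    exact ⟨(a / 2, 1 / 2), by constructor <;> constructor <;> simp <;> linarith⟩
  · rw [rect, Set.snd_image_prod (Set.nonempty_Icc.2 (by linarith)), zero_add]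

variable {J : Type*} {len : J → ℝ}

/-- A tile of a tiling of a strip by rectangles of height `1` lies between the horizontal sides. -/
theorem exists_eq_rect_of_subset {x a : ℝ} (hlen : ∀ j, 0 < len j) {σ : Set (ℝ × ℝ)}
    (hσ : ∃ τ ∈ Set.range (fun j => rect 0 (len j)), ∃ v : ℝ × ℝ, σ = (fun p => v + p) '' τ)
    (hsub : σ ⊆ stripFrom x a) :
    ∃ y j, σ = rect y (len j) ∧ x ≤ y ∧ y + len j ≤ x + a := by
  obtain ⟨_, ⟨j, rfl⟩, v, rfl⟩ := hσ
  have hj := hlen j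
  simp only [translate_rect] at hsub ⊢
  have h1 := @hsub (v.1, v.2) ⟨⟨le_rfl, by simpa using hj.le⟩, le_rfl, by simp⟩
  have h2 := @hsub (v.1 + len j, v.2 + 1) ⟨⟨by simpa using hj.le, le_rfl⟩, by simp, le_rfl⟩
  simp only [stripFrom, Set.mem_ofPred_eq, Set.mem_Icc] at h1 h2
  obtain ⟨_, ⟨h3, -⟩, h4, -⟩ := h1
  obtain ⟨_, ⟨-, h5⟩, -, h6⟩ := h2
  have hv : v.2 = 0 := by linarith
  exact ⟨v.1, j, by rw [hv, rect, zero_add], h3, h5⟩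

/-- Two rectangles with disjoint interiors, the first of which starts no later, are in order. -/
theorem add_le_of_disjoint_interior {x y a b : ℝ} (hb : 0 < b) (hxy : x ≤ y)
    (h : Disjoint (interior (rect x a)) (interior (rect y b))) : x + a ≤ y := by
  by_contra! hlt
  -- The point of abscissa z at height 1/2 would lie in both interiors.
  obtain ⟨z, hz1, hz2⟩ := exists_between (lt_min hlt (by linarith : y < y + b))
  rw [lt_min_iff] at hz2
  simp only [interior_rect] at h
  exact Set.disjoint_left.1 h (show (z, (1 / 2 : ℝ)) ∈ _ from
    ⟨⟨by linarith, hz2.1⟩, by norm_num, by norm_num⟩) ⟨⟨hz1, hz2.2⟩, by norm_num, by norm_num⟩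

theorem disjoint_interior_of_add_le {x y a b : ℝ} (h : x + a ≤ y) :
    Disjoint (interior (rect x a)) (interior (rect y b)) := by
  simp only [interior_rect, Set.disjoint_left]
  rintro p ⟨⟨_, h1⟩, _⟩ ⟨⟨h2, _⟩, _⟩
  linarith

theorem rect_left_injective {x y a b : ℝ} (ha : 0 < a) (hb : 0 < b) (h : rect x a = rect y b) :
    x = y ∧ a = b := by
  have h1 : (x, (0 : ℝ)) ∈ rect y b := h ▸ (by simp [rect, ha.le])
  have h2 : (y, (0 : ℝ)) ∈ rect x a := h ▸ (by simp [rect, hb.le])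
  have h3 : (x + a, (0 : ℝ)) ∈ rect y b := h ▸ (by simp [rect, ha.le])
  have h4 : (y + b, (0 : ℝ)) ∈ rect x a := h ▸ (by simp [rect, hb.le])
  simp only [rect, Set.mem_prod, Set.mem_Icc] at h1 h2 h3 h4
  have : x = y := le_antisymm h2.1.1 h1.1.1
  exact ⟨this, by linarith [h3.1.2, h4.1.2]⟩

theorem sum_map_nonneg (hlen : ∀ j, 0 < len j) (l : List J) : 0 ≤ (l.map len).sum :=
  List.sum_nonneg (by simpa using fun j _ => (hlen j).le)

theorem exists_of_mem_wordTiling (hlen : ∀ j, 0 < len j) {σ : Set (ℝ × ℝ)} (l : List J) (x : ℝ)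
    (hσ : σ ∈ wordTiling len x l) :
    ∃ y j, σ = rect y (len j) ∧ x ≤ y := by
  induction l generalizing x with
  | nil => simp [wordTiling] at hσ
  | cons j l ih =>
    rcases hσ with rfl | hσ
    · exact ⟨x, j, rfl, le_rfl⟩
    · obtain ⟨y, i, rfl, h⟩ := ih _ hσ
      exact ⟨y, i, rfl, by linarith [hlen j]⟩

theorem sUnion_wordTiling (hlen : ∀ j, 0 < len j) (l : List J) (x : ℝ) :
    ⋃₀ wordTiling len x l = stripFrom x (l.map len).sum := by
  induction l generalizing x with
  | nil => simp [wordTiling, stripFrom_zero]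
  | cons j l ih =>
    have hj := hlen j
    have hl := sum_map_nonneg hlen l
    rw [wordTiling, Set.sUnion_insert, ih, List.map_cons, List.sum_cons]
    ext p
    simp only [rect, stripFrom, Set.mem_union, Set.mem_prod, Set.mem_ofPred_eq, Set.mem_Icc]
    constructor
    · rintro (⟨⟨h1, h2⟩, h3⟩ | ⟨h0, ⟨h1, h2⟩, h3⟩)
      · exact ⟨by linarith, ⟨h1, by linarith⟩, h3⟩
      · exact ⟨by linarith, ⟨by linarith, by linarith⟩, h3⟩
    · rintro ⟨h0, ⟨h1, h2⟩, h3⟩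
      rcases le_or_gt p.1 (x + len j) with h | h
      · exact Or.inl ⟨⟨h1, h⟩, h3⟩
      · exact Or.inr ⟨by linarith, ⟨h.le, by linarith⟩, h3⟩

theorem isTiling_wordTiling (hlen : ∀ j, 0 < len j) (l : List J) (x : ℝ) :
    IsTiling (Set.range fun j => rect 0 (len j)) (stripFrom x (l.map len).sum)
      (wordTiling len x l) := by
  refine ⟨?_, ?_, ?_, sUnion_wordTiling hlen l x⟩
  · induction l generalizing x with
    | nil => exact Set.finite_empty
    | cons j l ih => exact (ih _).insert _
  · intro σ hσ
    obtain ⟨y, j, rfl, -⟩ := exists_of_mem_wordTiling hlen l x hσ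
    exact ⟨_, ⟨j, rfl⟩, (y, 0), by rw [translate_rect]; simp [rect]⟩
  · induction l generalizing x with
    | nil => simp [wordTiling]
    | cons j l ih =>
      rintro σ (rfl | hσ) σ' (rfl | hσ') hne
      · exact absurd rfl hne
      · obtain ⟨y, i, rfl, h⟩ := exists_of_mem_wordTiling hlen l _ hσ'
        exact disjoint_interior_of_add_le h
      · obtain ⟨y, i, rfl, h⟩ := exists_of_mem_wordTiling hlen l _ hσ
        exact (disjoint_interior_of_add_le h).symm
      · exact ih _ σ hσ σ' hσ' hne

/-- Only the first rectangle has its left side at x, so the tiling determines the first letter, and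
removing that rectangle leaves the tiling of the tail. -/
theorem wordTiling_injective (hlen : ∀ j, 0 < len j) (hinj : Function.Injective len) (x : ℝ) :
    Function.Injective (wordTiling len x) := by
  intro l
  induction l generalizing x with
  | nil =>
    rintro (_ | ⟨j, l'⟩) h
    · rfl
    · exact absurd h.symm (Set.insert_nonempty _ _).ne_empty
  | cons j l ih =>
    rintro (_ | ⟨j', l'⟩) h
    · exact absurd h (Set.insert_nonempty _ _).ne_empty
    have hnot : ∀ (i k : J) (l : List J), rect x (len i) ∉ wordTiling len (x + len k) l := by
      intro i k l hmem
      obtain ⟨y, i', he, hy⟩ := exists_of_mem_wordTiling hlen l _ hmem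
      have := (rect_left_injective (hlen _) (hlen _) he).1
      linarith [hlen k]
    have hj : j = j' := by
      have h1 : rect x (len j) ∈ wordTiling len x (j' :: l') := h ▸ Set.mem_insert _ _
      rcases h1 with h1 | h1
      · exact hinj (rect_left_injective (hlen _) (hlen _) h1).2
      · exact absurd h1 (hnot _ _ _)
    subst hj
    have htail : wordTiling len (x + len j) l = wordTiling len (x + len j) l' := by
      have h2 := congrArg (· \ {rect x (len j)}) h
      simpa only [wordTiling, Set.insert_sdiff_self_of_notMem (hnot j j _)] using h2
    rw [ih _ htail]

theorem exists_wordTiling_eq (hlen : ∀ j, 0 < len j) (P : Set (Set (ℝ × ℝ))) (x a : ℝ)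
    (ha : 0 ≤ a)
    (hP : IsTiling (Set.range fun j => rect 0 (len j)) (stripFrom x a) P) :
    ∃ l : List J, (l.map len).sum = a ∧ wordTiling len x l = P := by
  obtain ⟨N, hN⟩ : ∃ N, P.ncard = N := ⟨_, rfl⟩
  induction N generalizing P x a with
  | zero =>
    have hP0 : P = ∅ := (Set.ncard_eq_zero hP.1).1 hN
    subst hP0
    refine ⟨[], ?_, rfl⟩
    by_contra hne
    have hpos : 0 < a := lt_of_le_of_ne ha (by simpa using hne)
    have h := hP.2.2.2
    rw [stripFrom_of_pos x hpos, Set.sUnion_empty] at h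
    have : (x, (0 : ℝ)) ∈ (∅ : Set (ℝ × ℝ)) := h ▸ (by simp [rect, ha])
    exact this
  | succ N ih =>
    obtain ⟨hfin, htile, hdisj, hU⟩ := hP
    have hrect : ∀ σ ∈ P, ∃ y j, σ = rect y (len j) ∧ x ≤ y ∧ y + len j ≤ x + a :=
      fun σ hσ => exists_eq_rect_of_subset hlen (htile σ hσ) (hU ▸ Set.subset_sUnion_of_mem hσ)
    have hpos : 0 < a := by
      obtain ⟨σ, hσ⟩ := Set.nonempty_of_ncard_ne_zero (by omega : P.ncard ≠ 0)
      obtain ⟨y, j, -, h1, h2⟩ := hrect σ hσ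
      linarith [hlen j]
    -- The tile covering the corner (x, 0) cannot start before x, so it starts at x; it gives the
    -- first letter.
    obtain ⟨j, hj, hja⟩ : ∃ j, rect x (len j) ∈ P ∧ len j ≤ a := by
      have hx : (x, (0 : ℝ)) ∈ ⋃₀ P := by
        rw [hU, stripFrom_of_pos x hpos]
        simp [rect, ha]
      obtain ⟨σ, hσ, hxσ⟩ := hx
      obtain ⟨y, j, rfl, h1, h2⟩ := hrect σ hσ
      have : y = x := le_antisymm hxσ.1.1 h1
      subst this
      exact ⟨j, hσ, by linarith⟩
    have hrest : ∀ σ ∈ P \ {rect x (len j)}, ∃ y i, σ = rect y (len i) ∧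
        x + len j ≤ y ∧ y + len i ≤ x + a := by
      rintro σ ⟨hσ, hne⟩
      obtain ⟨y, i, rfl, h1, h2⟩ := hrect σ hσ
      exact ⟨y, i, rfl, add_le_of_disjoint_interior (hlen _) h1
        (hdisj _ hj _ hσ (Ne.symm hne)), h2⟩
    -- The other tiles are only known to cover the points strictly to the right of the first one;
    -- closedness adds the common edge.
    have hclosed : IsClosed (⋃₀ (P \ {rect x (len j)})) := by
      rw [Set.sUnion_eq_biUnion]
      refine (hfin.subset Set.sdiff_subset).isClosed_biUnion fun σ hσ => ?_
      obtain ⟨y, i, rfl, -⟩ := hrest σ hσ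
      exact isClosed_Icc.prod isClosed_Icc
    have hU' : ⋃₀ (P \ {rect x (len j)}) = stripFrom (x + len j) (a - len j) := by
      refine Set.Subset.antisymm ?_ ?_
      · rintro p ⟨σ, hσ, hp⟩
        obtain ⟨y, i, rfl, h1, h2⟩ := hrest σ hσ
        have := hlen i
        exact ⟨by linarith, ⟨by linarith [hp.1.1], by linarith [hp.1.2]⟩, hp.2⟩
      · rcases eq_or_lt_of_le hja with h | h
        · rw [h, sub_self, stripFrom_zero]
          exact Set.empty_subset _
        · have hsub : Set.Ioc (x + len j) (x + a) ×ˢ Set.Icc (0 : ℝ) 1 ⊆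
              ⋃₀ (P \ {rect x (len j)}) := by
            rintro p ⟨⟨h1, h2⟩, h3⟩
            have hp : p ∈ ⋃₀ P := by
              rw [hU]
              exact ⟨hpos, ⟨by linarith [hlen j], h2⟩, h3⟩
            obtain ⟨σ, hσ, hpσ⟩ := hp
            refine ⟨σ, ⟨hσ, ?_⟩, hpσ⟩
            rintro rfl
            exact absurd hpσ.1.2 (not_le.2 h1)
          have := hclosed.closure_subset_iff.2 hsub
          rw [closure_prod_eq, closure_Ioc (by linarith), closure_Icc] at this
          rw [stripFrom_of_pos _ (by linarith), rect, show x + len j + (a - len j) = x + a by ring]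
          exact this
    obtain ⟨l, hl, hlP⟩ := ih (P \ {rect x (len j)}) (x + len j) (a - len j) (by linarith)
      ⟨hfin.subset Set.sdiff_subset, fun σ hσ => htile σ hσ.1,
        fun σ hσ σ' hσ' => hdisj σ hσ.1 σ' hσ'.1, hU'⟩
      (by rw [Set.ncard_sdiff_singleton_of_mem hj, hN]; rfl)
    refine ⟨j :: l, by simp [hl], ?_⟩
    rw [wordTiling, hlP, Set.insert_sdiff_singleton, Set.insert_eq_of_mem hj]

/-- Tilings of a strip by rectangles of height `1` correspond to words in their lengths. -/
theorem encard_tilings_eq (hlen : ∀ j, 0 < len j) (hinj : Function.Injective len) {a : ℝ}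
    (ha : 0 ≤ a) :
    Set.encard {P | IsTiling (Set.range fun j => rect 0 (len j)) (strip a) P} =
      Set.encard {l : List J | (l.map len).sum = a} := by
  rw [← (wordTiling_injective hlen hinj 0).encard_image {l : List J | (l.map len).sum = a},
    strip_eq_stripFrom]
  congr 1
  ext P
  constructor
  · exact fun hP => exists_wordTiling_eq hlen P 0 a ha hP
  · rintro ⟨l, rfl, rfl⟩
    exact isTiling_wordTiling hlen l 0

/-! ### Multinomial count of words -/

/-- The words with a given number of occurrences of each letter are counted by the multinomial
coefficient. -/
theorem exists_finset_count_eq {J : Type*} [Fintype J] [DecidableEq J] (c : J → ℕ) :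
    ∃ F : Finset (List J), (∀ l, l ∈ F ↔ ∀ j, l.count j = c j) ∧
      F.card * ∏ j, (c j).factorial = (∑ j, c j).factorial := by
  obtain ⟨N, hN⟩ : ∃ N, ∑ j, c j = N := ⟨_, rfl⟩
  induction N generalizing c with
  | zero =>
    have hc : ∀ j, c j = 0 := by simpa using hN
    refine ⟨{[]}, fun l => ?_, by simp [hc]⟩
    simp only [Finset.mem_singleton, hc, List.count_eq_zero]
    exact List.eq_nil_iff_forall_not_mem
  | succ N ih =>
    -- Sort words by first letter: those starting with i contribute c i * N! after clearing
    -- denominators, and summing over i gives (N + 1) * N!.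
    have hstep : ∀ i, c i ≠ 0 → ∃ F : Finset (List J),
        (∀ l, l ∈ F ↔ ∀ j, (i :: l).count j = c j) ∧
        F.card * ∏ j, (c j).factorial = c i * N.factorial := by
      intro i hi
      set d : J → ℕ := Function.update c i (c i - 1) with hd
      have hci : c i = (c i - 1) + 1 := by omega
      have hsum : ∑ j, d j = N := by
        have h1 := Finset.add_sum_erase Finset.univ c (Finset.mem_univ i)
        have h2 := Finset.add_sum_erase Finset.univ d (Finset.mem_univ i)
        have h3 : ∑ j ∈ Finset.univ.erase i, d j = ∑ j ∈ Finset.univ.erase i, c j :=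
          Finset.sum_congr rfl fun j hj => Function.update_of_ne (Finset.ne_of_mem_erase hj) _ _
        have h4 : d i = c i - 1 := Function.update_self _ _ _
        omega
      have hprod : ∏ j, (c j).factorial = c i * ∏ j, (d j).factorial := by
        rw [← Finset.mul_prod_erase Finset.univ _ (Finset.mem_univ i),
          ← Finset.mul_prod_erase Finset.univ (fun j => (d j).factorial) (Finset.mem_univ i)]
        have h3 : ∏ j ∈ Finset.univ.erase i, (d j).factorial =
            ∏ j ∈ Finset.univ.erase i, (c j).factorial :=
          Finset.prod_congr rfl fun j hj => by
            rw [hd, Function.update_of_ne (Finset.ne_of_mem_erase hj)]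
        have h4 : d i = c i - 1 := Function.update_self _ _ _
        rw [h3, h4, ← mul_assoc, Nat.mul_factorial_pred hi]
      obtain ⟨F, hF, hcard⟩ := ih d hsum
      refine ⟨F, fun l => ?_, ?_⟩
      · rw [hF]
        refine forall_congr' fun j => ?_
        rcases eq_or_ne j i with rfl | hj
        · rw [hd, Function.update_self, List.count_cons_self]
          omega
        · rw [hd, Function.update_of_ne hj, List.count_cons_of_ne hj.symm]
      · rw [hprod, mul_left_comm, hcard, hsum]
    choose! F hF hcard using hstep
    refine ⟨(Finset.univ.filter fun i => c i ≠ 0).biUnion fun i => (F i).image (List.cons i),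
      fun l => ?_, ?_⟩
    · simp only [Finset.mem_biUnion, Finset.mem_filter, Finset.mem_univ, true_and,
        Finset.mem_image]
      constructor
      · rintro ⟨i, hi, l, hl, rfl⟩
        exact (hF i hi l).1 hl
      · intro hl
        rcases l with _ | ⟨i, l⟩
        · simp only [List.count_nil] at hl
          simp [← hl] at hN
        · have hi : c i ≠ 0 := by
            rw [← hl i, List.count_cons_self]
            omega
          exact ⟨i, hi, l, (hF i hi l).2 hl, rfl⟩
    · rw [Finset.card_biUnion, Finset.sum_mul, hN, Nat.factorial_succ, ← hN, Finset.sum_mul,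
        ← Finset.sum_filter_add_sum_filter_not Finset.univ (fun i => c i ≠ 0)
          (fun i => c i * N.factorial)]
      · rw [Finset.sum_eq_zero (s := Finset.univ.filter fun i => ¬ c i ≠ 0), add_zero]
        · refine Finset.sum_congr rfl fun i hi => ?_
          rw [Finset.card_image_of_injective _ (List.cons_injective),
            hcard i (Finset.mem_filter.1 hi).2]
        · intro i hi
          have : c i = 0 := by simpa using hi
          simp [this]
      · intro i _ i' _ hne
        simp only [Function.onFun, Finset.disjoint_left, Finset.mem_image]
        rintro _ ⟨l, _, rfl⟩ ⟨l', _, h⟩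
        exact hne (List.cons.inj h).1.symm

/-! ### Independence of the powers of a transcendental number -/

theorem exists_transcendental_mem_Ioo : ∃ t : ℝ, t ∈ Set.Ioo (0 : ℝ) 1 ∧ Transcendental ℤ t := by
  by_contra! h
  have hsub : Set.Ioo (0 : ℝ) 1 ⊆ {x : ℝ | IsAlgebraic ℤ x} := fun t ht =>
    not_not.1 (h t ht)
  exact absurd (Cardinal.Real.Ioo_countable_iff.1 ((Algebraic.countable ℤ ℝ).mono hsub)) (by norm_num)

/-- The powers of a transcendental number up to the sixth are linearly independent. -/
theorem coeff_eq_zero_of_transcendental {t : ℝ} (ht : Transcendental ℤ t)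
    {a₀ a₁ a₂ a₃ a₄ a₅ a₆ : ℤ}
    (h : (a₀ : ℝ) + a₁ * t + a₂ * t ^ 2 + a₃ * t ^ 3 + a₄ * t ^ 4 + a₅ * t ^ 5 + a₆ * t ^ 6 = 0) :
    a₀ = 0 ∧ a₁ = 0 ∧ a₂ = 0 ∧ a₃ = 0 ∧ a₄ = 0 ∧ a₅ = 0 ∧ a₆ = 0 := by
  have hp := (transcendental_iff.1 ht)
    (.monomial 0 a₀ + .monomial 1 a₁ + .monomial 2 a₂ + .monomial 3 a₃ + .monomial 4 a₄ +
      .monomial 5 a₅ + .monomial 6 a₆) (by simpa [Polynomial.aeval_monomial] using h)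
  have hc := fun n => congrArg (fun p => Polynomial.coeff p n) hp
  simp only [Polynomial.coeff_add, Polynomial.coeff_monomial, Polynomial.coeff_zero] at hc
  exact ⟨by simpa using hc 0, by simpa using hc 1, by simpa using hc 2, by simpa using hc 3,
    by simpa using hc 4, by simpa using hc 5, by simpa using hc 6⟩

theorem coeff_eq_of_transcendental {t : ℝ} (ht : Transcendental ℤ t)
    {a₀ a₁ a₂ a₃ a₄ a₅ a₆ b₀ b₁ b₂ b₃ b₄ b₅ b₆ : ℤ}
    (h : (a₀ : ℝ) + a₁ * t + a₂ * t ^ 2 + a₃ * t ^ 3 + a₄ * t ^ 4 + a₅ * t ^ 5 + a₆ * t ^ 6 =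
      b₀ + b₁ * t + b₂ * t ^ 2 + b₃ * t ^ 3 + b₄ * t ^ 4 + b₅ * t ^ 5 + b₆ * t ^ 6) :
    a₀ = b₀ ∧ a₁ = b₁ ∧ a₂ = b₂ ∧ a₃ = b₃ ∧ a₄ = b₄ ∧ a₅ = b₅ ∧ a₆ = b₆ := by
  have := coeff_eq_zero_of_transcendental ht (a₀ := a₀ - b₀) (a₁ := a₁ - b₁) (a₂ := a₂ - b₂)
    (a₃ := a₃ - b₃) (a₄ := a₄ - b₄) (a₅ := a₅ - b₅) (a₆ := a₆ - b₆)
    (by push_cast; linear_combination h)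
  simpa only [sub_eq_zero] using this

/-! ### Asymptotics of central binomials, Catalan numbers and word counts -/

theorem factorial_two_mul (n : ℕ) :
    ((2 * n).factorial : ℝ) = n.centralBinom * (n.factorial : ℝ) ^ 2 := by
  have := Nat.choose_mul_factorial_mul_factorial (show n ≤ 2 * n by omega)
  rw [show 2 * n - n = n by omega] at this
  rw [Nat.centralBinom_eq_two_mul_choose, ← this]
  push_cast
  ring

theorem tendsto_centralBinom :
    Tendsto (fun n : ℕ => (n.centralBinom : ℝ) * √n / 4 ^ n) atTop (𝓝 (1 / √Real.pi)) := by
  have hpi : √Real.pi ≠ 0 := by positivity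
  -- The sequence equals `stirlingSeq (2 * n) / stirlingSeq n ^ 2` for n > 0.
  have h := (Stirling.tendsto_stirlingSeq_sqrt_pi.comp
    (tendsto_id.const_mul_atTop' (two_pos : (0 : ℕ) < 2))).div
      (Stirling.tendsto_stirlingSeq_sqrt_pi.pow 2) (pow_ne_zero 2 hpi)
  have hlim : √Real.pi / √Real.pi ^ 2 = 1 / √Real.pi := by field_simp
  rw [hlim] at h
  refine h.congr' ?_
  filter_upwards [eventually_gt_atTop 0] with n hn
  have hn' : (0 : ℝ) < n := by exact_mod_cast hn
  have hs : √(n : ℝ) ^ 2 = n := Real.sq_sqrt hn'.le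
  have hs0 : √(n : ℝ) ≠ 0 := by positivity
  have h4 : √(2 * ((2 * n : ℕ) : ℝ)) = 2 * √n := by
    rw [show (2 * ((2 * n : ℕ) : ℝ)) = 2 ^ 2 * n by push_cast; ring,
      Real.sqrt_mul (by positivity), Real.sqrt_sq (by norm_num)]
  have h2 : √(2 * (n : ℝ)) ^ 2 = 2 * √n ^ 2 := by rw [Real.sq_sqrt (by positivity), hs]
  have hp : (((2 * n : ℕ) : ℝ) / Real.exp 1) ^ (2 * n) = 4 ^ n * ((n / Real.exp 1) ^ n) ^ 2 := by
    rw [← pow_mul, mul_comm n 2, show (4 : ℝ) ^ n = 2 ^ (2 * n) by rw [pow_mul]; norm_num,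
      ← mul_pow]
    push_cast
    ring
  have hf : (n.factorial : ℝ) ≠ 0 := by positivity
  have he : ((n : ℝ) / Real.exp 1) ^ n ≠ 0 := by positivity
  simp only [Pi.div_apply, Function.comp, id]
  rw [Stirling.stirlingSeq, Stirling.stirlingSeq, h4, hp,
    factorial_two_mul]
  generalize ((n : ℝ) / Real.exp 1) ^ n = E at *
  rw [div_pow, mul_pow, h2]
  field_simp

theorem tendsto_catalan :
    Tendsto (fun n : ℕ => (catalan n : ℝ) * (n * √n) / 4 ^ n) atTop (𝓝 (1 / √Real.pi)) := by
  have h := tendsto_centralBinom.mul (tendsto_natCast_div_add_atTop (1 : ℝ))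
  rw [mul_one] at h
  refine h.congr fun n => ?_
  rw [← succ_mul_catalan_eq_centralBinom]
  have : (n : ℝ) + 1 ≠ 0 := by positivity
  push_cast
  field_simp

/-- The number of words in seven letters that occur `2 m - i`, `2 m + i`, `m`, `m`, `m`, `m` and
`1` times. -/
noncomputable def wordCount (i m : ℕ) : ℝ :=
  (8 * m + 1).factorial /
    ((2 * m - i).factorial * (2 * m + i).factorial * (m.factorial : ℝ) ^ 4)

/-- Split (8m)! by repeated halving: 8m into 4m + 4m, both into 2m + 2m, and two of the four blocks
2m into m + m. -/
theorem wordCount_zero (m : ℕ) : wordCount 0 m =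
    (8 * m + 1) * ((4 * m).centralBinom * (2 * m).centralBinom ^ 2 * m.centralBinom ^ 2) := by
  have h8 := factorial_two_mul (4 * m)
  have h4 := factorial_two_mul (2 * m)
  rw [show 2 * (4 * m) = 8 * m by ring] at h8
  rw [show 2 * (2 * m) = 4 * m by ring] at h4
  have hm : (m.factorial : ℝ) ≠ 0 := by positivity
  have h2m : ((2 * m).factorial : ℝ) ≠ 0 := by positivity
  simp only [wordCount, Nat.factorial_succ, Nat.sub_zero, Nat.add_zero]
  rw [div_eq_iff (by positivity)]
  push_cast
  rw [h8, h4, factorial_two_mul m]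
  ring

/-- The ratio tends to 1 for fixed i, which is why the limit of `wordCount i` does not depend on i.
-/
theorem wordCount_succ {i m : ℕ} (h : i + 1 ≤ 2 * m) :
    wordCount (i + 1) m = wordCount i m * ((2 * m - i) / (2 * m + i + 1)) := by
  have h1 : 2 * m - i = (2 * m - (i + 1)) + 1 := by omega
  have h2 : ((2 * m - i : ℕ) : ℝ) = 2 * m - i := by
    rw [Nat.cast_sub (by omega)]
    push_cast
    ring
  have h3 : ((2 * m - i).factorial : ℝ) = (2 * m - i) * (2 * m - (i + 1)).factorial := by
    rw [← h2, h1, Nat.factorial_succ]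
    push_cast
    simp
  have h4 : ((2 * m + (i + 1)).factorial : ℝ) = (2 * m + i + 1) * (2 * m + i).factorial := by
    rw [← add_assoc, Nat.factorial_succ]
    push_cast
    ring
  have h5 : (2 * (m : ℝ) - i) ≠ 0 := by
    rw [← h2]
    exact_mod_cast (by omega : 2 * m - i ≠ 0)
  have h6 : (2 * (m : ℝ) + i + 1) ≠ 0 := by positivity
  rw [wordCount, wordCount, h3, h4]
  field_simp

theorem tendsto_wordCount (i : ℕ) :
    Tendsto (fun m : ℕ => wordCount i m * (m * √m) / 4 ^ (10 * m)) atTop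
      (𝓝 (2 * (1 / √Real.pi) ^ 5)) := by
  induction i with
  | zero =>
    have hc : ∀ a : ℕ, 0 < a → Tendsto
        (fun m : ℕ => ((a * m).centralBinom : ℝ) * √((a * m : ℕ) : ℝ) / 4 ^ (a * m)) atTop
        (𝓝 (1 / √Real.pi)) := fun a ha =>
      tendsto_centralBinom.comp (tendsto_id.const_mul_atTop' ha)
    have h8 : Tendsto (fun m : ℕ => (2 : ℝ) + 1 / 4 * (m : ℝ)⁻¹) atTop (𝓝 2) := by
      simpa only [mul_zero, add_zero] using
        ((tendsto_inv_atTop_nhds_zero_nat (𝕜 := ℝ)).const_mul (1 / 4)).const_add 2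
    have h := h8.mul (((hc 4 (by norm_num)).mul ((hc 2 (by norm_num)).pow 2)).mul
      (tendsto_centralBinom.pow 2))
    rw [show 2 * (1 / √Real.pi) ^ 5 =
      2 * (1 / √Real.pi * (1 / √Real.pi) ^ 2 * (1 / √Real.pi) ^ 2) by ring]
    refine h.congr' ?_
    filter_upwards [eventually_gt_atTop 0] with m hm
    have hm' : (0 : ℝ) < m := by exact_mod_cast hm
    have hs : √(m : ℝ) ^ 2 = m := Real.sq_sqrt hm'.le
    have h4 : √((4 * m : ℕ) : ℝ) = 2 * √m := by
      rw [show ((4 * m : ℕ) : ℝ) = 2 ^ 2 * m by push_cast; ring,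
        Real.sqrt_mul (by positivity), Real.sqrt_sq (by norm_num)]
    have h2 : √((2 * m : ℕ) : ℝ) ^ 2 = 2 * m := by
      rw [Real.sq_sqrt (by positivity)]
      push_cast
      ring
    have hp : (4 : ℝ) ^ (10 * m) = 4 ^ (4 * m) * (4 ^ (2 * m)) ^ 2 * (4 ^ m) ^ 2 := by
      rw [← pow_mul, ← pow_mul, ← pow_add, ← pow_add]
      congr 1
      ring
    rw [wordCount_zero, hp, div_pow, div_pow, mul_pow, mul_pow, h4, h2, hs]
    field_simp
    ring
  | succ i ih =>
    have hr : Tendsto (fun m : ℕ => (2 * (m : ℝ) - i) / (2 * m + i + 1)) atTop (𝓝 1) := by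
      have hinv := tendsto_inv_atTop_nhds_zero_nat (𝕜 := ℝ)
      have h1 : Tendsto (fun m : ℕ => 2 - (i : ℝ) * (m : ℝ)⁻¹) atTop (𝓝 2) := by
        simpa using (hinv.const_mul (i : ℝ)).const_sub 2
      have h2 : Tendsto (fun m : ℕ => 2 + ((i : ℝ) + 1) * (m : ℝ)⁻¹) atTop (𝓝 2) := by
        simpa using (hinv.const_mul ((i : ℝ) + 1)).const_add 2
      have h := h1.div h2 two_ne_zero
      rw [div_self two_ne_zero] at h
      refine h.congr' ?_
      filter_upwards [eventually_gt_atTop 0] with m hm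
      have hm' : (0 : ℝ) < m := by exact_mod_cast hm
      simp only [Pi.div_apply]
      field_simp
      ring
    have h := ih.mul hr
    rw [mul_one] at h
    refine h.congr' ?_
    filter_upwards [eventually_ge_atTop (i + 1)] with m hm
    rw [wordCount_succ (by omega)]
    ring

/-! ### From residue classes modulo 10 to the Catalan asymptotics -/

theorem tendsto_of_tendsto_residues {u : ℕ → ℝ} {a : ℝ} (q d : ℕ) (hd : 0 < d)
    (h : ∀ j < d, Tendsto (fun k => u (d * (k + q) + j)) atTop (𝓝 a)) :
    Tendsto u atTop (𝓝 a) := by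
  intro s hs
  have hev : ∀ᶠ k in atTop, ∀ j ∈ Finset.range d, u (d * (k + q) + j) ∈ s :=
    (Finset.eventually_all _).2 fun j hj => h j (Finset.mem_range.1 hj) hs
  obtain ⟨K, hK⟩ := eventually_atTop.1 hev
  refine mem_map.2 ?_
  filter_upwards [eventually_ge_atTop (d * (K + q))] with n hn
  have h1 : K + q ≤ n / d := (Nat.le_div_iff_mul_le hd).2 (by rwa [mul_comm])
  have h2 := hK (n / d - q) (by omega) (n % d) (Finset.mem_range.2 (Nat.mod_lt _ hd))
  rwa [Nat.sub_add_cancel (by omega), Nat.div_add_mod] at h2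

/-- A sequence whose residue classes modulo `10` are suitable sums of the numbers `wordCount i k`
is asymptotic to a multiple of the Catalan numbers. -/
theorem asymptoticTo_catalan {f : ℕ → ℕ} {M q : ℕ} {A : ℝ} (hM : 0 < M)
    (hA : A = M * (20 * √10 / Real.pi ^ 2) / 4 ^ (10 * q))
    (hf : ∀ j < 10, ∀ k, M * 4 ^ j ≤ 2 * k →
      (f (10 * (k + q) + j) : ℝ) = ∑ i ∈ Finset.range (M * 4 ^ j), wordCount i k) :
    AsymptoticTo (fun n => (f n : ℝ)) (fun n => A * (catalan n : ℝ)) := by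
  have hApos : 0 < A := by
    rw [hA]
    positivity
  refine tendsto_of_tendsto_residues q 10 (by norm_num) fun j hj => ?_
  have hsum : Tendsto (fun k : ℕ => ∑ i ∈ Finset.range (M * 4 ^ j),
      wordCount i k * (k * √k) / 4 ^ (10 * k)) atTop
      (𝓝 (∑ _i ∈ Finset.range (M * 4 ^ j), 2 * (1 / √Real.pi) ^ 5)) :=
    tendsto_finsetSum _ fun i _ => tendsto_wordCount i
  have hn : Tendsto (fun k : ℕ => 10 * (k + q) + j) atTop atTop :=
    tendsto_atTop_mono (fun k => (by omega : k ≤ 10 * (k + q) + j)) tendsto_id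
  have hcat := tendsto_catalan.comp hn
  have hquot : Tendsto (fun k : ℕ => ((10 * (k + q) + j : ℕ) : ℝ) / k) atTop (𝓝 10) := by
    have h : Tendsto (fun k : ℕ => 10 + (10 * q + j : ℝ) * (k : ℝ)⁻¹) atTop (𝓝 10) := by
      simpa using ((tendsto_inv_atTop_nhds_zero_nat (𝕜 := ℝ)).const_mul
        (10 * q + j : ℝ)).const_add 10
    refine h.congr' ?_
    filter_upwards [eventually_gt_atTop 0] with k hk
    have hk' : (0 : ℝ) < k := by exact_mod_cast hk
    push_cast
    field_simp
    ring
  have hpow := hquot.mul hquot.sqrt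
  have hpi : (0 : ℝ) < Real.pi := Real.pi_pos
  have h := ((hsum.mul hpow).div (hcat.const_mul (A * 4 ^ (10 * q + j)))
    (by positivity))
  -- The M * 4 ^ j equal summands cancel the 4 ^ j of the Catalan growth; 10 √10 is the limit of (n
  -- / k) ^ (3/2).
  have hlim : (∑ _i ∈ Finset.range (M * 4 ^ j), 2 * (1 / √Real.pi) ^ 5) * (10 * √10) /
      (A * 4 ^ (10 * q + j) * (1 / √Real.pi)) = 1 := by
    have h4 : √Real.pi ^ 4 = Real.pi ^ 2 := by
      rw [show √Real.pi ^ 4 = (√Real.pi ^ 2) ^ 2 by ring, Real.sq_sqrt hpi.le]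
    have hM' : (M : ℝ) ≠ 0 := by positivity
    rw [hA, Finset.sum_const, Finset.card_range, nsmul_eq_mul, ← h4]
    push_cast
    field_simp
    ring
  rw [hlim] at h
  refine h.congr' ?_
  -- For such k the condition in `hf` holds, so no subtraction 2k - i is truncated.
  filter_upwards [eventually_ge_atTop (M * 4 ^ j), eventually_gt_atTop 0] with k hk hk0
  have hk' : (0 : ℝ) < k := by exact_mod_cast hk0
  have hc0 : (catalan (10 * (k + q) + j) : ℝ) ≠ 0 := by
    have h1 := succ_mul_catalan_eq_centralBinom (10 * (k + q) + j)
    intro h0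
    rw [Nat.cast_eq_zero.1 h0, mul_zero] at h1
    exact Nat.centralBinom_ne_zero _ h1.symm
  have hN : (0 : ℝ) < ((10 * (k + q) + j : ℕ) : ℝ) := by exact_mod_cast (by omega)
  simp only [Pi.div_apply, Function.comp, hf j hj k (by omega)]
  have hp : (4 : ℝ) ^ (10 * (k + q) + j) = 4 ^ (10 * k) * 4 ^ (10 * q + j) := by
    rw [← pow_add]
    congr 1
    ring
  rw [← Finset.sum_div, ← Finset.sum_mul, Real.sqrt_div hN.le, hp]
  have hs1 : √(k : ℝ) ≠ 0 := by positivity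
  have hs2 : √((10 * (k + q) + j : ℕ) : ℝ) ≠ 0 := by positivity
  field_simp

/-! ### The alphabet and its words of given length -/

/-- Six basic letters, and `M * 4 ^ j` marked letters for each residue `j` modulo `10`. -/
abbrev Letter (M : ℕ) : Type := Fin 6 ⊕ (Σ j : Fin 10, Fin (M * 4 ^ (j : ℕ)))

/-- The lengths of the letters. With weights `2, 2, 1, 1, 1, 1` the lengths of the basic letters
sum to `10`, and for transcendental `t` this is essentially the only relation between them. -/
noncomputable def letterLength (t : ℝ) (M q : ℕ) : Letter M → ℝ :=
  Sum.elim
    ![t, t ^ 2, t ^ 3, t ^ 4, t ^ 5, 10 - 2 * t - 2 * t ^ 2 - t ^ 3 - t ^ 4 - t ^ 5]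
    -- The term i (t - t ^ 2) is compensated by i fewer letters t and i more letters t ^ 2; the
    -- integer 10 q delays the count and so divides it by 4 ^ (10 q) asymptotically.
    (fun e => t ^ 6 + ((e.1 : ℕ) + 10 * q : ℕ) + ((e.2 : ℕ) : ℝ) * (t - t ^ 2))

/-- The number of occurrences of each letter in a word of total length `10 (k + q) + j + t ^ 6`
that contains the marked letter `e`. -/
def letterCount {M : ℕ} (k : ℕ) (e : Σ j : Fin 10, Fin (M * 4 ^ (j : ℕ))) : Letter M → ℕ :=
  Sum.elim ![2 * k - e.2, 2 * k + e.2, k, k, k, k] (fun e' => if e' = e then 1 else 0)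

theorem letterLength_pos {t : ℝ} (ht : t ∈ Set.Ioo (0 : ℝ) 1) (M q : ℕ) (x : Letter M) :
    0 < letterLength t M q x := by
  obtain ⟨h0, h1⟩ := ht
  have hp : ∀ n : ℕ, t ^ n ≤ 1 := fun n => pow_le_one₀ h0.le h1.le
  rcases x with x | e
  · fin_cases x <;> simp [letterLength, h0]
    linarith [hp 2, hp 3, hp 4, hp 5]
  · have : 0 ≤ t - t ^ 2 := by nlinarith
    simp only [letterLength, Sum.elim_inr]
    positivity

theorem sum_map_eq_sum_count {J : Type*} [Fintype J] [DecidableEq J] (len : J → ℝ) (l : List J) :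
    (l.map len).sum = ∑ j, (l.count j : ℝ) * len j := by
  induction l with
  | nil => simp
  | cons i l ih =>
    simp only [List.map_cons, List.sum_cons, ih, List.count_cons, Nat.cast_add, add_mul,
      Finset.sum_add_distrib]
    simp [add_comm]

/-- Sorting by powers of t leaves integer coefficients, as `coeff_eq_of_transcendental` requires. -/
theorem sum_mul_letterLength (t : ℝ) (M q : ℕ) (c : Letter M → ℕ) :
    ∑ x, (c x : ℝ) * letterLength t M q x =
      ((10 * c (.inl 5) + (∑ e, c (.inr e) * ((e.1 : ℕ) + 10 * q) : ℕ) : ℤ) : ℝ) +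
      ((c (.inl 0) - 2 * c (.inl 5) + (∑ e, c (.inr e) * (e.2 : ℕ) : ℕ) : ℤ) : ℝ) * t +
      ((c (.inl 1) - 2 * c (.inl 5) - (∑ e, c (.inr e) * (e.2 : ℕ) : ℕ) : ℤ) : ℝ) * t ^ 2 +
      ((c (.inl 2) - c (.inl 5) : ℤ) : ℝ) * t ^ 3 + ((c (.inl 3) - c (.inl 5) : ℤ) : ℝ) * t ^ 4 +
      ((c (.inl 4) - c (.inl 5) : ℤ) : ℝ) * t ^ 5 +
      (((∑ e, c (.inr e) : ℕ) : ℤ) : ℝ) * t ^ 6 := by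
  have h : ∑ e, (c (.inr e) : ℝ) * letterLength t M q (.inr e) =
      (∑ e, (c (.inr e) : ℝ) * (((e.1 : ℕ) : ℝ) + 10 * q)) +
      (∑ e, (c (.inr e) : ℝ) * ((e.2 : ℕ) : ℝ)) * (t - t ^ 2) +
      (∑ e, (c (.inr e) : ℝ)) * t ^ 6 := by
    rw [Finset.sum_mul, Finset.sum_mul, ← Finset.sum_add_distrib, ← Finset.sum_add_distrib]
    refine Finset.sum_congr rfl fun e _ => ?_
    simp only [letterLength, Sum.elim_inr]
    push_cast
    ring
  rw [Fintype.sum_sum_type, h, Fin.sum_univ_six]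
  have h6 : letterLength t M q (.inl 0) = t ∧ letterLength t M q (.inl 1) = t ^ 2 ∧
      letterLength t M q (.inl 2) = t ^ 3 ∧ letterLength t M q (.inl 3) = t ^ 4 ∧
      letterLength t M q (.inl 4) = t ^ 5 ∧
      letterLength t M q (.inl 5) = 10 - 2 * t - 2 * t ^ 2 - t ^ 3 - t ^ 4 - t ^ 5 :=
    ⟨rfl, rfl, rfl, rfl, rfl, rfl⟩
  rw [h6.1, h6.2.1, h6.2.2.1, h6.2.2.2.1, h6.2.2.2.2.1, h6.2.2.2.2.2]
  push_cast
  ring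

theorem letterLength_injective {t : ℝ} (ht : Transcendental ℤ t) (M q : ℕ) :
    Function.Injective (letterLength t M q) := by
  intro x y hxy
  -- A letter is viewed as a one-letter word, so that coefficients can be compared.
  have hsingle : ∀ z : Letter M, letterLength t M q z =
      ∑ w, ((Pi.single z 1 : Letter M → ℕ) w : ℝ) * letterLength t M q w := by
    intro z
    simp [Pi.single_apply]
  rw [hsingle x, hsingle y, sum_mul_letterLength, sum_mul_letterLength] at hxy
  obtain ⟨h0, h1, h2, h3, h4, h5, h6⟩ := coeff_eq_of_transcendental ht hxy
  rcases x with x | ⟨j, i⟩ <;> rcases y with y | ⟨j', i'⟩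
  · have hall : ∀ z : Fin 6, (Pi.single (.inl x) 1 : Letter M → ℕ) (.inl z) =
        (Pi.single (.inl y) 1 : Letter M → ℕ) (.inl z) := by
      simp only [Pi.single_apply, reduceCtorEq, if_false, zero_mul, Finset.sum_const_zero]
        at h0 h1 h2 h3 h4 h5 ⊢
      intro z
      fin_cases z <;> simp only [Fin.zero_eta, Fin.mk_one, Fin.reduceFinMk] <;> omega
    have := hall x
    simpa [Pi.single_apply] using this
  · simp [Pi.single_apply] at h6
  · simp [Pi.single_apply] at h6
  · simp [Pi.single_apply] at h0 h1
    obtain rfl : j = j' := Fin.ext (by exact_mod_cast h0)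
    obtain rfl : i = i' := Fin.ext (by exact_mod_cast h1)
    rfl

theorem sum_mul_letterLength_eq_iff {t : ℝ} (ht : Transcendental ℤ t) {M q n : ℕ}
    (c : Letter M → ℕ) :
    ∑ x, (c x : ℝ) * letterLength t M q x = n + t ^ 6 ↔
      ∃ k e, n = 10 * (k + q) + (e.1 : ℕ) ∧ (e.2 : ℕ) ≤ 2 * k ∧ ∀ x, c x = letterCount k e x := by
  rw [sum_mul_letterLength]
  constructor
  · intro h
    obtain ⟨h0, h1, h2, h3, h4, h5, h6⟩ := coeff_eq_of_transcendental ht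
      (b₀ := n) (b₁ := 0) (b₂ := 0) (b₃ := 0) (b₄ := 0) (b₅ := 0) (b₆ := 1)
      (h.trans (by push_cast; ring))
    -- The coefficient of t ^ 6 counts marked letters, so there is exactly one.
    have hone : ∑ e, c (.inr e) = 1 := by exact_mod_cast h6
    obtain ⟨e, -, he⟩ : ∃ e ∈ Finset.univ, c (.inr e) ≠ 0 :=
      Finset.exists_ne_zero_of_sum_ne_zero (by rw [hone]; exact one_ne_zero)
    have hsplit := Finset.add_sum_erase Finset.univ (fun e => c (.inr e)) (Finset.mem_univ e)
    have hzero : ∀ e', e' ≠ e → c (.inr e') = 0 := by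
      have : ∑ e' ∈ Finset.univ.erase e, c (.inr e') = 0 := by
        simp only [hone] at hsplit
        omega
      intro e' he'
      exact Finset.sum_eq_zero_iff.1 this e' (Finset.mem_erase.2 ⟨he', Finset.mem_univ _⟩)
    have hce : c (.inr e) = 1 := by
      rw [← hone]
      exact (Finset.sum_eq_single e (fun e' _ he' => hzero e' he') (by simp)).symm
    have hsum : ∀ g : (Σ j : Fin 10, Fin (M * 4 ^ (j : ℕ))) → ℕ,
        ∑ e, c (.inr e) * g e = g e := by
      intro g
      rw [Finset.sum_eq_single e (fun e' _ he' => by rw [hzero e' he', zero_mul]) (by simp), hce,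
        one_mul]
    rw [hsum (fun e => (e.1 : ℕ) + 10 * q)] at h0
    rw [hsum (fun e => (e.2 : ℕ))] at h1 h2
    refine ⟨c (.inl 5), e, by omega, by omega, ?_⟩
    rintro (z | e')
    · fin_cases z <;> simp [letterCount] <;> omega
    · rcases eq_or_ne e' e with rfl | he'
      · simp [letterCount, hce]
      · simp [letterCount, hzero e' he', he']
  · rintro ⟨k, e, rfl, hk, hc⟩
    obtain rfl : c = letterCount k e := funext hc
    have h6 : letterCount k e (.inl 0) = 2 * k - e.2 ∧ letterCount k e (.inl 1) = 2 * k + e.2 ∧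
        letterCount k e (.inl 2) = k ∧ letterCount k e (.inl 3) = k ∧
        letterCount k e (.inl 4) = k ∧ letterCount k e (.inl 5) = k := ⟨rfl, rfl, rfl, rfl, rfl, rfl⟩
    have hinr : ∀ e', letterCount k e (.inr e') = if e' = e then 1 else 0 := fun _ => rfl
    simp only [h6, hinr, ite_mul, one_mul, zero_mul, Finset.sum_ite_eq', Finset.mem_univ, if_true]
    push_cast [Nat.cast_sub hk]
    ring

theorem prod_factorial_letterCount {M : ℕ} (k : ℕ) (e : Σ j : Fin 10, Fin (M * 4 ^ (j : ℕ))) :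
    ∏ x, (letterCount k e x).factorial =
      (2 * k - e.2).factorial * (2 * k + e.2).factorial * k.factorial ^ 4 := by
  rw [Fintype.prod_sum_type, Fin.prod_univ_six, Finset.prod_eq_one (s := Finset.univ)
    (f := fun e' => (letterCount k e (.inr e')).factorial)]
  · change (2 * k - e.2).factorial * (2 * k + e.2).factorial * k.factorial * k.factorial *
      k.factorial * k.factorial * 1 = _
    ring
  · intro e' _
    simp only [letterCount, Sum.elim_inr]
    split_ifs <;> rfl

theorem sum_letterCount {M k : ℕ} {e : Σ j : Fin 10, Fin (M * 4 ^ (j : ℕ))}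
    (hk : (e.2 : ℕ) ≤ 2 * k) : ∑ x, letterCount k e x = 8 * k + 1 := by
  rw [Fintype.sum_sum_type, Fin.sum_univ_six]
  have : ∑ e', letterCount k e (.inr e') = 1 := by simp [letterCount]
  rw [this]
  change (2 * k - e.2) + (2 * k + e.2) + k + k + k + k + 1 = _
  omega

/-- Since k ≤ n, only finitely many count vectors occur. Finiteness is needed for every n because
`ncard` is 0 on infinite sets. -/
theorem finite_words {t : ℝ} (ht : Transcendental ℤ t) (M q n : ℕ) :
    {l : List (Letter M) | (l.map (letterLength t M q)).sum = n + t ^ 6}.Finite := by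
  choose F hF _ using fun p : Fin (n + 1) × (Σ j : Fin 10, Fin (M * 4 ^ (j : ℕ))) =>
    exists_finset_count_eq (letterCount (p.1 : ℕ) p.2)
  refine (Finset.univ.biUnion F).finite_toSet.subset fun l hl => ?_
  rw [Set.mem_ofPred_eq, sum_map_eq_sum_count, sum_mul_letterLength_eq_iff ht] at hl
  obtain ⟨k, e, hn, -, hc⟩ := hl
  exact Finset.mem_coe.2 (Finset.mem_biUnion.2
    ⟨(⟨k, by omega⟩, e), Finset.mem_univ _, (hF (⟨k, by omega⟩, e) l).2 hc⟩)

theorem ncard_words {t : ℝ} (ht : Transcendental ℤ t) {M q k j : ℕ} (hj : j < 10)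
    (hk : M * 4 ^ j ≤ 2 * k) :
    ({l : List (Letter M) | (l.map (letterLength t M q)).sum =
      ((10 * (k + q) + j : ℕ) : ℝ) + t ^ 6}.ncard : ℝ) =
      ∑ i ∈ Finset.range (M * 4 ^ j), wordCount i k := by
  choose F hF hcard using fun i : Fin (M * 4 ^ j) =>
    exists_finset_count_eq (letterCount (M := M) k ⟨⟨j, hj⟩, i⟩)
  have hset : {l : List (Letter M) | (l.map (letterLength t M q)).sum =
      ((10 * (k + q) + j : ℕ) : ℝ) + t ^ 6} = ↑(Finset.univ.biUnion F) := by
    ext l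
    rw [Set.mem_ofPred_eq, sum_map_eq_sum_count, sum_mul_letterLength_eq_iff ht, Finset.mem_coe,
      Finset.mem_biUnion]
    constructor
    · rintro ⟨k', ⟨j', i⟩, hn, -, hc⟩
      have hj' := j'.2
      -- Both j and j' are below 10, so division by 10 recovers k and j.
      obtain rfl : k' = k := by dsimp only at hn; omega
      obtain rfl : j' = ⟨j, hj⟩ := Fin.ext (by dsimp only at hn ⊢; omega)
      exact ⟨i, Finset.mem_univ _, (hF i l).2 hc⟩
    · rintro ⟨i, -, hi⟩
      exact ⟨k, ⟨⟨j, hj⟩, i⟩, rfl, i.2.le.trans hk, (hF i l).1 hi⟩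
  rw [hset, Set.ncard_coe_finset, Finset.card_biUnion, Nat.cast_sum, ← Fin.sum_univ_eq_sum_range]
  · refine Finset.sum_congr rfl fun i _ => ?_
    have h := hcard i
    rw [prod_factorial_letterCount, sum_letterCount (i.2.le.trans hk)] at h
    rw [wordCount, ← h, eq_div_iff (by positivity)]
    push_cast
    rfl
  · intro i _ i' _ hne
    simp only [Function.onFun, Finset.disjoint_left]
    intro l hl hl'
    have h1 := (hF i l).1 hl (.inr ⟨⟨j, hj⟩, i⟩)
    have h2 := (hF i' l).1 hl' (.inr ⟨⟨j, hj⟩, i⟩)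
    rw [h1] at h2
    simp [letterCount, hne] at h2

/-! ### Choice of the constants and conclusion -/

/-- Integral multiples of `c / 4 ^ (10 q)` come arbitrarily close to `1`. -/
theorem exists_mul_div_mem_Ioo {c ε : ℝ} (hc : 0 < c) (hε : 0 < ε) :
    ∃ M q : ℕ, 0 < M ∧ M * c / 4 ^ (10 * q) ∈ Set.Ioo (1 - ε) (1 + ε) := by
  -- This q makes the mesh c / 4 ^ (10 q) smaller than ε; M then rounds 4 ^ (10 q) / c up.
  obtain ⟨q, hq⟩ := pow_unbounded_of_one_lt (c / ε) (by norm_num : (1 : ℝ) < 4 ^ 10)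
  rw [← pow_mul] at hq
  have hp : (0 : ℝ) < 4 ^ (10 * q) := by positivity
  have h1 := Nat.le_ceil ((4 : ℝ) ^ (10 * q) / c)
  have h2 := Nat.ceil_lt_add_one (show 0 ≤ (4 : ℝ) ^ (10 * q) / c by positivity)
  refine ⟨⌈(4 : ℝ) ^ (10 * q) / c⌉₊, q, Nat.ceil_pos.2 (by positivity), ?_, ?_⟩
  · rw [div_le_iff₀ hc] at h1
    exact lt_of_lt_of_le (by linarith) ((one_le_div hp).2 h1)
  · rw [div_lt_iff₀ hε] at hq
    rw [div_add_one hc.ne', lt_div_iff₀ hc] at h2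
    rw [div_lt_iff₀ hp]
    linarith

end IrrationalTilings

open IrrationalTilings in
theorem mainTheorem6 (ε : ℝ) (hε : 0 < ε) :
    ∃ f : ℕ → ℕ, IrrationalTilings.IsTileCountingFunction f ∧
      ∃ A ∈ Set.Ioo (1 - ε) (1 + ε),
        IrrationalTilings.AsymptoticTo (fun n => (f n : ℝ)) (fun n => A * (catalan n : ℝ)) := by
  obtain ⟨t, ht01, ht⟩ := exists_transcendental_mem_Ioo
  obtain ⟨M, q, hM, hA⟩ := exists_mul_div_mem_Ioo
    (show 0 < 20 * √10 / Real.pi ^ 2 by positivity) hε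
  have ht6 : 0 < t ^ 6 := pow_pos ht01.1 6
  refine ⟨fun n => {l : List (Letter M) | (l.map (letterLength t M q)).sum = n + t ^ 6}.ncard,
    ⟨Set.range fun x => rect 0 (letterLength t M q x), t ^ 6, Set.finite_range _, ?_, ht6.le,
      fun n => ?_⟩, _, hA, asymptoticTo_catalan hM rfl fun j hj k hk => ncard_words ht hj hk⟩
  · rintro _ ⟨x, rfl⟩
    exact isTallTile_rect (letterLength_pos ht01 M q x)
  · rw [encard_tilings_eq (letterLength_pos ht01 M q) (letterLength_injective ht M q)
      (by positivity), (finite_words ht M q n).cast_ncard_eq]
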